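/- Let $\mathbb K$ be an algebraically closed field. The dimension of a set of matrices is its Krull dimension in the Zariski topology, and the codimension of a nonempty set in a matrix space is the number of matrix entries minus its dimension. For integers $p\ge q\ge 2$ and $0\le \ell\le q$, let ${}_{\ell}C_{p,q}$ be the codimension in $\mathrm{Mat}_{p\times 2q}(\mathbb K)$ of the variety ${}_{\ell}\mathbf X_{p,q}$ of all matrices $(\alpha_1,\dots,\alpha_q,\beta_1,\dots,\beta_q)$ with: (i) $\operatorname{rank}\{\alpha_1,\dots,\alpha_q\}\le \ell$; (ii) for every $\nu=1,\dots,q$, $\operatorname{rank}\{\alpha_1,\dots,\widehat{\alpha_\nu},\dots,\alpha_q,\ \alpha_\nu+(\beta_1+\cdots+\beta_q)\}\le q-1$; (iii) for every $\tau=1,\dots,q-1$ and $\rho=\tau+1,\dots,q$, $\operatorname{rank}\{\alpha_1+\beta_1,\dots,\alpha_\tau+\beta_\tau,\alpha_{\tau+1},\dots,\widehat{\alpha_\rho},\dots,\alpha_q,\ \alpha_\rho+(\beta_{\tau+1}+\cdots+\beta_q)\}\le q-1$. For integers $N\ge 3$, $c,r\ge 0$ with $2c+r\ge N$, and $k=1,\dots,N-1$,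 let $\mathscr M^{N,k}_{2c+r}\subset \mathrm{Mat}_{(2c+r)\times(N+1+k+1)}(\mathbb K)$ be the variety of all matrices $(\alpha_0\mid\dots\mid\alpha_N\mid\beta_0\mid\dots\mid\beta_k)$ with: (i) $\alpha_0+\cdots+\alpha_N+\beta_0+\cdots+\beta_k=\mathbf 0$; (ii) for every $\nu=0,\dots,k$, $\operatorname{rank}\{\alpha_0,\dots,\widehat{\alpha_\nu},\dots,\alpha_N,\ \alpha_\nu+(\beta_0+\cdots+\beta_k)\}\le N-1$; (iii) for every $\tau=0,\dots,k-1$ and $\rho=\tau+1,\dots,k$, $\operatorname{rank}\{\alpha_0+\beta_0,\dots,\alpha_\tau+\beta_\tau,\alpha_{\tau+1},\dots,\widehat{\alpha_\rho},\dots,\alpha_N,\ \alpha_\rho+(\beta_{\tau+1}+\cdots+\beta_k)\}\le N-1$. Here a hat means that the vector is omitted. **Sharp Core Lemma.** For all integers $N\ge 3$, $c,r\ge 0$ with $2c+r\ge N$, and $k=1,\dots,N-1$, $$\operatorname{codim}\mathscr M^{N,k}_{2c+r}\ \ge\ {}_{k+1}C_{2c+r-N+k+1,\,k+1}+(2c+r)\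 \ge\ 2(2c+r)-N+k+1 .$$ -/

import Mathlib

/-! ### Zariski topology, dimension and codimension in a space of matrices -/

/-- The polynomial ring of functions on the affine space of `m × n` matrices has one variable for
each entry.  A matrix gives a point of its prime spectrum: the ideal of the polynomials that vanish
at that matrix. -/
noncomputable def matPoint {K : Type*} [Field K] {m n : Type*} (A : Matrix m n K) :
    PrimeSpectrum (MvPolynomial (m × n) K) :=
  MvPolynomial.pointToPoint (k := K) (fun ij : m × n => A ij.1 ij.2)

/-- The Zariski topology on a set `Z` of matrices (the topology induced from the spectrum).
`isClosed_zariskiOn_iff` says that its closed sets are the sets of common zeros in `Z` of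
families of polynomials in the matrix entries. -/
@[reducible]
noncomputable def zariskiOn {K : Type*} [Field K] {m n : Type*} (Z : Set (Matrix m n K)) :
    TopologicalSpace Z :=
  TopologicalSpace.induced (fun A : Z => matPoint A.1) inferInstance

theorem isClosed_zariskiOn_iff {K : Type*} [Field K] {m n : Type*} (Z : Set (Matrix m n K))
    (W : Set Z) :
    @IsClosed Z (zariskiOn Z) W ↔
      ∃ S : Set (MvPolynomial (m × n) K),
        W = {A : Z | ∀ f ∈ S, MvPolynomial.eval (fun ij : m × n => A.1 ij.1 ij.2) f = 0} := by
  let _ := zariskiOn Z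
  have key : ∀ S : Set (MvPolynomial (m × n) K),
      (fun A : Z => matPoint A.1) ⁻¹' PrimeSpectrum.zeroLocus S =
        {A : Z | ∀ f ∈ S, MvPolynomial.eval (fun ij : m × n => A.1 ij.1 ij.2) f = 0} := by
    intro S
    ext A
    simp only [Set.mem_preimage, PrimeSpectrum.mem_zeroLocus, Set.mem_ofPred_eq]
    constructor
    · intro h f hf
      have h1 := (MvPolynomial.mem_vanishingIdeal_singleton_iff _ f).1 (h hf)
      simpa [MvPolynomial.aeval_eq_eval] using h1
    · intro h f hf
      refine (MvPolynomial.mem_vanishingIdeal_singleton_iff _ f).2 ?_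
      simpa [MvPolynomial.aeval_eq_eval] using h f hf
  rw [isClosed_induced_iff]
  constructor
  · rintro ⟨t, ht, rfl⟩
    obtain ⟨S, rfl⟩ := (PrimeSpectrum.isClosed_iff_zeroLocus t).1 ht
    exact ⟨S, key S⟩
  · rintro ⟨S, rfl⟩
    exact ⟨_, PrimeSpectrum.isClosed_zeroLocus S, key S⟩

/-- The dimension of a set of matrices: its Krull dimension in the Zariski topology, i.e. the
supremum of the lengths of chains of irreducible closed subsets (`⊥` for the empty set). -/
noncomputable def matDim {K : Type*} [Field K] {m n : Type*} (Z : Set (Matrix m n K)) :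
    WithBot ℕ∞ :=
  @topologicalKrullDim Z (zariskiOn Z)

/-- The dimension never exceeds the number of entries. -/
theorem matDim_le {K : Type*} [Field K] {m n : Type*} [Finite m] [Finite n]
    (Z : Set (Matrix m n K)) : matDim Z ≤ (Nat.card (m × n) : ℕ∞) := by
  let _ := zariskiOn Z
  have h : Topology.IsInducing (fun A : Z => matPoint A.1) := ⟨rfl⟩
  refine h.topologicalKrullDim_le.trans ?_
  rw [PrimeSpectrum.topologicalKrullDim_eq_ringKrullDim,
    MvPolynomial.ringKrullDim_of_isNoetherianRing, ringKrullDim_eq_zero_of_field]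
  simp

/-- The codimension of a set of matrices in the affine space of all `m × n` matrices: the number
of entries minus the dimension, and `⊤` for the empty set.  By `matDim_le` the subtraction is
never truncated. -/
noncomputable def matCodim {K : Type*} [Field K] {m n : Type*} (Z : Set (Matrix m n K)) : ℕ∞ :=
  WithBot.recBotCoe ⊤ (fun d : ℕ∞ => (Nat.card (m × n) : ℕ∞) - d) (matDim Z)

/-! ### The varieties of matrices -/

/-- Rank of a finite family of vectors: the dimension of the space they span. -/
noncomputable def vrank (K : Type*) [Field K] {V : Type*} [AddCommGroup V] [Module K V]
    {a : ℕ} (v : Fin a → V) : ℕ :=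
  Module.finrank K (Submodule.span K (Set.range v))

/-- For `α_0, …, α_{a-1}` and `β_0, …, β_{b-1}` and indices `t ≤ ρ < b ≤ a`, the family
`α_0 + β_0, …, α_{t-1} + β_{t-1}, α_t, …, α_ρ + (β_t + ⋯ + β_{b-1}), …, α_{a-1}`
in which `α_j` is replaced by `α_j + β_j` for `j < t`, and `α_ρ` by `α_ρ + (β_t + ⋯ + β_{b-1})`.
For `t = 0` it is `α_0, …, α_ρ + (β_0 + ⋯ + β_{b-1}), …, α_{a-1}`. -/
def movedFamily {V : Type*} [AddCommGroup V] {a b : ℕ} (α : Fin a → V) (β : Fin b → V)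
    (t ρ : ℕ) : Fin a → V := fun j =>
  if (j : ℕ) < t then α j + (if h : (j : ℕ) < b then β ⟨j, h⟩ else 0)
  else if (j : ℕ) = ρ then α j + ∑ i : Fin b, (if t ≤ (i : ℕ) then β i else 0)
  else α j

/-- The variety `ₗX_{p,q}` of `p × 2q` matrices `(α_1, …, α_q, β_1, …, β_q)`; the columns are
numbered from `0` here, so `α_{j+1}` is the column `Sum.inl j` and `β_{j+1}` is `Sum.inr j`. -/
def coreVariety (K : Type*) [Field K] (l p q : ℕ) : Set (Matrix (Fin p) (Fin q ⊕ Fin q) K) :=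
  {A |
    let α : Fin q → Fin p → K := fun j => A.col (Sum.inl j)
    let β : Fin q → Fin p → K := fun j => A.col (Sum.inr j)
    vrank K α ≤ l ∧
    (∀ ν : ℕ, ν < q → vrank K (movedFamily α β 0 ν) ≤ q - 1) ∧
    (∀ t ρ : ℕ, 1 ≤ t → t ≤ ρ → ρ < q → vrank K (movedFamily α β t ρ) ≤ q - 1)}

/-- The codimension `ₗC_{p,q}` of `ₗX_{p,q}` in the space of `p × 2q` matrices. -/
noncomputable def coreCodim (K : Type*) [Field K] (l p q : ℕ) : ℕ∞ :=
  matCodim (coreVariety K l p q)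

/-- The variety `𝓜_P^{N,k}` of `P × (N+1+k+1)` matrices `(α_0 | … | α_N | β_0 | … | β_k)`: the sum
of all columns is zero, and the families obtained by moving the coefficients have rank at most
`N - 1`.  In the last condition `t = τ + 1` for `τ = 0, …, k - 1`, and `ρ = τ + 1, …, k`. -/
def movingVariety (K : Type*) [Field K] (P N k : ℕ) :
    Set (Matrix (Fin P) (Fin (N + 1) ⊕ Fin (k + 1)) K) :=
  {A |
    let α : Fin (N + 1) → Fin P → K := fun j => A.col (Sum.inl j)
    let β : Fin (k + 1) → Fin P → K := fun j => A.col (Sum.inr j)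
    (∑ j, α j + ∑ j, β j = 0) ∧
    (∀ ν : ℕ, ν ≤ k → vrank K (movedFamily α β 0 ν) ≤ N - 1) ∧
    (∀ t ρ : ℕ, 1 ≤ t → t ≤ ρ → ρ ≤ k → vrank K (movedFamily α β t ρ) ≤ N - 1)}

-- Write P = 2c + r. For l = q the rank condition on the α_j is void and ₗC_{p,q} equals p
-- (`coreCodim_self`). The middle term is therefore exactly 2P - N + k + 1, and all that remains is
-- dim 𝓜 ≤ P(k+N) + N - (k+1).
--
-- Dimensions are bounded above at generic points (`matDim_le_of_generic_points`): it suffices that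
-- the entries, in an extension field L, lie in a K-algebra with few generators. A vector in the
-- L-span of r known vectors costs r generators, its coefficients, instead of P. Put γ_j = α_j +
-- β_j. Each moved family is the staircase γ_0, …, γ_{t-1}, α_t, …, α_{N-1} with the sum of the
-- remaining β_j added at one place ρ. If the staircase is independent, dependence for all ρ in [t,
-- k] forces γ_t + ⋯ + γ_k into the span of the N - (k+1) + t vectors that stay fixed
-- (`sum_mem_span_fixedIndices`), so γ_k is cheap. If it is dependent, either the fixed part is
-- dependent, or some α_m lies in the span of later α_j and fixed vectors; for m < k one then passes
-- to t = m + 1. This is `entriesGeneratedBy_laterIndices`, used at t = 0.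
--
-- For the lower bound on the dimension of the core variety, matrices whose columns sum to zero form
-- a linear subspace of it, since moving preserves the sum.

universe u

/-! ### Bounding Krull dimensions by numbers of generators -/

/-- A finitely generated algebra over a field that embeds in a field extension, with image inside
a subalgebra generated by `n` elements, has Krull dimension at most `n`. -/
theorem ringKrullDim_le_of_injective_of_mem_adjoin {K A L : Type*} [Field K] [CommRing A]
    [Algebra K A] [Algebra.FiniteType K A] [Field L] [Algebra K L] (f : A →ₐ[K] L)
    (hf : Function.Injective f) (T : Finset L) (hT : ∀ x, f x ∈ Algebra.adjoin K (T : Set L)) :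
    ringKrullDim A ≤ T.card := by
  have : Nontrivial A := f.toRingHom.domain_nontrivial
  -- Noether normalization: `A` is integral over a polynomial ring in `s` variables, and `s` is
  -- bounded by the transcendence degree of the algebra generated by `T`.
  obtain ⟨s, g, hg, hint⟩ := exists_integral_inj_algHom_of_fg K A
  have hs : s ≤ T.card := by
    let E := Algebra.adjoin K (T : Set L)
    let h : MvPolynomial (Fin s) K →ₐ[K] E := (f.comp g).codRestrict E (fun x => hT _)
    have hh : Function.Injective h := by
      intro x y hxy
      exact hg (hf (congrArg Subtype.val hxy))
    have hind : AlgebraicIndependent K (fun i => h (MvPolynomial.X i)) := by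
      have : MvPolynomial.aeval (fun i => h (MvPolynomial.X i)) = h := by
        ext i; simp
      rw [AlgebraicIndependent, this]
      exact hh
    have h1 := hind.lift_cardinalMk_le_trdeg
    let S : Set E := Subtype.val ⁻¹' (T : Set L)
    have htop : Algebra.adjoin K S = ⊤ := Algebra.adjoin_adjoin_coe_preimage
    have : Algebra.IsAlgebraic (Algebra.adjoin K S) E := by
      refine ⟨fun x => ?_⟩
      have hx : x ∈ Algebra.adjoin K S := htop ▸ Algebra.mem_top
      exact isAlgebraic_algebraMap (A := E) (⟨x, hx⟩ : Algebra.adjoin K S)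
    have h2 := Algebra.IsAlgebraic.trdeg_le_cardinalMk (R := K) S
    have h3 : Cardinal.mk S ≤ T.card := by
      have : Cardinal.mk S ≤ Cardinal.mk (T : Set L) :=
        Cardinal.mk_preimage_of_injective _ _ Subtype.val_injective
      simpa using this
    have h4 := h2.trans h3
    have h5 : Cardinal.lift.{_, 0} (Cardinal.mk (Fin s)) ≤ Cardinal.lift.{0, _} (T.card : Cardinal) :=
      h1.trans (Cardinal.lift_le.2 h4)
    simpa using h5
  have hdim : ringKrullDim A ≤ ringKrullDim (MvPolynomial (Fin s) K) := by
    let _ : Algebra (MvPolynomial (Fin s) K) A := g.toRingHom.toAlgebra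
    have : Algebra.IsIntegral (MvPolynomial (Fin s) K) A := ⟨hint⟩
    refine Order.krullDim_le_of_strictMono
      (PrimeSpectrum.comap (algebraMap (MvPolynomial (Fin s) K) A)) ?_
    intro p q hpq
    exact Ideal.IsIntegral.comap_lt_comap (R := MvPolynomial (Fin s) K) (I := p.asIdeal) (J := q.asIdeal) hpq
  refine hdim.trans ?_
  rw [MvPolynomial.ringKrullDim_of_isNoetherianRing, ringKrullDim_eq_zero_of_field]
  simpa using hs

/-- A chain of primes above `I` lies above its own smallest member, so it is already a chain for
that prime. -/
theorem ringKrullDim_quotient_le_of_forall_prime {R : Type*} [CommRing R] (I : Ideal R)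
    (n : WithBot ℕ∞) (h : ∀ p : Ideal R, p.IsPrime → I ≤ p → ringKrullDim (R ⧸ p) ≤ n) :
    ringKrullDim (R ⧸ I) ≤ n := by
  rw [ringKrullDim_quotient, Order.krullDim]
  refine iSup_le fun l => ?_
  have hp := h l.head.1.asIdeal l.head.1.2 l.head.2
  refine le_trans ?_ hp
  rw [ringKrullDim_quotient]
  let l' : LTSeries (PrimeSpectrum.zeroLocus (R := R) l.head.1.asIdeal) :=
    { length := l.length
      toFun := fun i => ⟨(l i).1, (show l.head.1 ≤ (l i).1 from l.head_le i)⟩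
      step := fun i => l.step i }
  exact Order.LTSeries.length_le_krullDim l'

/-- A set of matrices has dimension at most `n` if every point, with entries in an extension
field, of its Zariski closure has its entries in an algebra generated by `n` elements. -/
theorem matDim_le_of_generic_points {K : Type u} [Field K] {m n : Type} [Finite m] [Finite n]
    (Z : Set (Matrix m n K)) (d : ℕ)
    (h : ∀ (L : Type u) [Field L] [Algebra K L] (x : Matrix m n L),
      (∀ f : MvPolynomial (m × n) K,
        (∀ A ∈ Z, MvPolynomial.eval (fun ij : m × n => A ij.1 ij.2) f = 0) →
          MvPolynomial.aeval (fun ij : m × n => x ij.1 ij.2) f = 0) →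
      ∃ T : Finset L, T.card ≤ d ∧ ∀ i j, x i j ∈ Algebra.adjoin K (T : Set L)) :
    matDim Z ≤ d := by
  let R := MvPolynomial (m × n) K
  let ev : Matrix m n K → R →+* K := fun A => MvPolynomial.eval (fun ij : m × n => A ij.1 ij.2)
  let I : Ideal R := ⨅ A ∈ Z, RingHom.ker (ev A)
  have hI : ∀ f, f ∈ I ↔ ∀ A ∈ Z, ev A f = 0 := by
    intro f; simp [I, RingHom.mem_ker]
  have hmat : ∀ A (f : R), f ∈ (matPoint A).asIdeal ↔ ev A f = 0 := by
    intro A f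
    refine (MvPolynomial.mem_vanishingIdeal_singleton_iff _ f).trans ?_
    rw [MvPolynomial.aeval_eq_eval]
  have h1 : matDim Z ≤ ringKrullDim (R ⧸ I) := by
    let _ := zariskiOn Z
    have hind : Topology.IsInducing (fun A : Z => matPoint A.1) := ⟨rfl⟩
    have hex : ∀ A : Z, ∃ q, PrimeSpectrum.comap (Ideal.Quotient.mk I) q = matPoint A.1 := by
      intro A
      have : matPoint A.1 ∈ Set.range (PrimeSpectrum.comap (Ideal.Quotient.mk I)) := by
        rw [range_comap_of_surjective _ _ Ideal.Quotient.mk_surjective,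
          PrimeSpectrum.mem_zeroLocus, Ideal.mk_ker]
        intro f hf
        exact (hmat A.1 f).2 ((hI f).1 hf A.1 A.2)
      exact this
    choose g hg using hex
    have hcomp : Topology.IsInducing g := by
      rw [← (PrimeSpectrum.comap_isInducing_of_surjective _ (Ideal.Quotient.mk I)
        Ideal.Quotient.mk_surjective).of_comp_iff]
      convert hind using 1
      funext A
      exact hg A
    refine hcomp.topologicalKrullDim_le.trans ?_
    rw [PrimeSpectrum.topologicalKrullDim_eq_ringKrullDim]
  refine h1.trans (ringKrullDim_quotient_le_of_forall_prime I _ fun p hp hIp => ?_)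
  -- The residue classes of the variables form the generic point of the closed set defined by `p`;
  -- polynomials vanishing on `Z` lie in `I ≤ p` and so vanish there.
  let L := FractionRing (R ⧸ p)
  let φ : (R ⧸ p) →ₐ[K] L := IsScalarTower.toAlgHom K (R ⧸ p) L
  have hφ : Function.Injective φ := IsFractionRing.injective (R ⧸ p) L
  let ψ : R →ₐ[K] L := φ.comp (Ideal.Quotient.mkₐ K p)
  have hψ : ψ = MvPolynomial.aeval (fun ij : m × n => ψ (MvPolynomial.X (ij.1, ij.2))) := by
    ext ij; simp
  obtain ⟨T, hTd, hT⟩ := h L (fun i j => ψ (MvPolynomial.X (i, j))) (by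
    intro f hf
    have hfp : f ∈ p := hIp ((hI f).2 hf)
    rw [← hψ]
    change φ (Ideal.Quotient.mk p f) = 0
    rw [Ideal.Quotient.eq_zero_iff_mem.2 hfp, map_zero])
  refine (ringKrullDim_le_of_injective_of_mem_adjoin φ hφ T ?_).trans (by exact_mod_cast hTd)
  intro x
  obtain ⟨f, rfl⟩ := Ideal.Quotient.mk_surjective x
  change ψ f ∈ _
  rw [hψ]
  induction f using MvPolynomial.induction_on with
  | C a =>
    rw [MvPolynomial.aeval_C]
    exact Subalgebra.algebraMap_mem (Algebra.adjoin K (T : Set L)) a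
  | add p q hp hq => rw [map_add]; exact add_mem hp hq
  | mul_X p ij hp => rw [map_mul, MvPolynomial.aeval_X]; exact mul_mem hp (hT _ _)

/-! ### Dimension of linear subspaces -/

theorem exists_polynomial_eval_line {K : Type*} [Field K] {σ : Type*} (x y : σ → K)
    (f : MvPolynomial σ K) :
    ∃ p : Polynomial K, ∀ t : K, p.eval t = MvPolynomial.eval (fun i => x i + t * (y i - x i)) f := by
  refine ⟨MvPolynomial.eval₂ Polynomial.C
    (fun i => Polynomial.C (x i) + Polynomial.X * Polynomial.C (y i - x i)) f, fun t => ?_⟩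
  rw [← Polynomial.coe_evalRingHom, MvPolynomial.hom_eval₂]
  rw [MvPolynomial.eval, MvPolynomial.coe_eval₂Hom]
  congr 1
  · ext; simp
  · funext i; simp

/-- Two polynomials that do not vanish identically on a linear subspace over an infinite field do
not vanish simultaneously at some point of it. -/
theorem exists_mem_submodule_eval_ne_zero {K : Type*} [Field K] [Infinite K] {m n : Type*}
    (U : Submodule K (Matrix m n K)) (f g : MvPolynomial (m × n) K) {A B : Matrix m n K}
    (hA : A ∈ U) (hB : B ∈ U)
    (hf : MvPolynomial.eval (fun ij : m × n => A ij.1 ij.2) f ≠ 0)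
    (hg : MvPolynomial.eval (fun ij : m × n => B ij.1 ij.2) g ≠ 0) :
    ∃ C ∈ U, MvPolynomial.eval (fun ij : m × n => C ij.1 ij.2) f ≠ 0 ∧
      MvPolynomial.eval (fun ij : m × n => C ij.1 ij.2) g ≠ 0 := by
  obtain ⟨p, hp⟩ := exists_polynomial_eval_line (fun ij : m × n => A ij.1 ij.2)
    (fun ij : m × n => B ij.1 ij.2) f
  obtain ⟨q, hq⟩ := exists_polynomial_eval_line (fun ij : m × n => A ij.1 ij.2)
    (fun ij : m × n => B ij.1 ij.2) g
  have hp0 : p ≠ 0 := by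
    rintro rfl
    apply hf
    rw [show (fun ij : m × n => A ij.1 ij.2) =
      (fun ij : m × n => A ij.1 ij.2 + 0 * (B ij.1 ij.2 - A ij.1 ij.2)) by simp, ← hp]
    simp
  have hq0 : q ≠ 0 := by
    rintro rfl
    apply hg
    rw [show (fun ij : m × n => B ij.1 ij.2) =
      (fun ij : m × n => A ij.1 ij.2 + 1 * (B ij.1 ij.2 - A ij.1 ij.2)) by simp, ← hq]
    simp
  obtain ⟨t, ht⟩ : ∃ t, (p * q).eval t ≠ 0 := by
    by_contra! h
    exact mul_ne_zero hp0 hq0 (Polynomial.funext (by simpa using h))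
  rw [Polynomial.eval_mul, hp, hq] at ht
  exact ⟨A + t • (B - A), U.add_mem hA (U.smul_mem t (U.sub_mem hB hA)),
    left_ne_zero_of_mul ht, right_ne_zero_of_mul ht⟩

/-- A linear functional that kills `U` but not `A` is a polynomial in the entries; hence linear
subspaces are Zariski closed. -/
theorem exists_linear_polynomial_separating {K : Type*} [Field K] {m n : Type*} [Finite m]
    [Finite n] (U : Submodule K (Matrix m n K)) {A : Matrix m n K} (hA : A ∉ U) :
    ∃ f : MvPolynomial (m × n) K,
      (∀ B ∈ U, MvPolynomial.eval (fun ij : m × n => B ij.1 ij.2) f = 0) ∧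
        MvPolynomial.eval (fun ij : m × n => A ij.1 ij.2) f ≠ 0 := by
  classical
  have := Fintype.ofFinite m
  have := Fintype.ofFinite n
  obtain ⟨φ, hφA, hφU⟩ := Submodule.exists_dual_map_eq_bot_of_notMem hA inferInstance
  have key : ∀ B : Matrix m n K, MvPolynomial.eval (fun ij : m × n => B ij.1 ij.2)
      (∑ ij : m × n, MvPolynomial.C (φ (Matrix.single ij.1 ij.2 1)) * MvPolynomial.X ij) = φ B := by
    intro B
    conv_rhs => rw [Matrix.matrix_eq_sum_single B]
    simp only [map_sum, map_mul, MvPolynomial.eval_C, MvPolynomial.eval_X]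
    rw [Fintype.sum_prod_type]
    refine Finset.sum_congr rfl fun i _ => Finset.sum_congr rfl fun j _ => ?_
    rw [show Matrix.single i j (B i j) = B i j • Matrix.single i j (1 : K) by
      simp [Matrix.smul_single], map_smul, smul_eq_mul, mul_comm]
  refine ⟨∑ ij : m × n, MvPolynomial.C (φ (Matrix.single ij.1 ij.2 1)) * MvPolynomial.X ij,
    fun B hB => ?_, ?_⟩
  · rw [key]
    have : φ B ∈ U.map φ := ⟨B, hB, rfl⟩
    rw [hφU] at this
    exact (Submodule.mem_bot K).1 this
  · rw [key]; exact hφA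

/-- A set of matrices that contains a linear subspace has at least its dimension. -/
theorem finrank_le_matDim {K : Type*} [Field K] [Infinite K] {m n : Type*} [Finite m] [Finite n]
    (Z : Set (Matrix m n K)) (W : Submodule K (Matrix m n K)) (hW : (W : Set (Matrix m n K)) ⊆ Z) :
    (Module.finrank K W : WithBot ℕ∞) ≤ matDim Z := by
  let _ := zariskiOn Z
  let S : Submodule K W → Set Z := fun U => {A | A.1 ∈ U.map W.subtype}
  have hSZ : ∀ (U : Submodule K W) (A : Matrix m n K), A ∈ U.map W.subtype → A ∈ Z := by
    rintro U _ ⟨A, _, rfl⟩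
    exact hW A.2
  have hclosed : ∀ U, IsClosed (S U) := by
    intro U
    rw [isClosed_zariskiOn_iff]
    refine ⟨{f | ∀ B ∈ U.map W.subtype,
      MvPolynomial.eval (fun ij : m × n => B ij.1 ij.2) f = 0}, ?_⟩
    ext A
    refine ⟨fun hA f hf => hf _ hA, fun hA => ?_⟩
    by_contra hAU
    obtain ⟨f, hf, hfA⟩ := exists_linear_polynomial_separating (U.map W.subtype) hAU
    exact hfA (hA f hf)
  have hirr : ∀ U, IsIrreducible (S U) := by
    intro U
    have h0 : (0 : Matrix m n K) ∈ U.map W.subtype := Submodule.zero_mem _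
    refine ⟨⟨⟨0, hSZ U 0 h0⟩, h0⟩, ?_⟩
    rintro u v hu hv ⟨A, hAU, hA⟩ ⟨B, hBU, hB⟩
    obtain ⟨s, hs⟩ := (isClosed_zariskiOn_iff Z uᶜ).1 hu.isClosed_compl
    obtain ⟨t, ht⟩ := (isClosed_zariskiOn_iff Z vᶜ).1 hv.isClosed_compl
    have hmem : ∀ (w : Set Z) (s : Set (MvPolynomial (m × n) K)),
        wᶜ = {A : Z | ∀ f ∈ s, MvPolynomial.eval (fun ij : m × n => A.1 ij.1 ij.2) f = 0} →
        ∀ A : Z, A ∈ w ↔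
          ∃ f ∈ s, MvPolynomial.eval (fun ij : m × n => A.1 ij.1 ij.2) f ≠ 0 := by
      intro w s h A
      rw [← not_iff_not, ← Set.mem_compl_iff, h]
      simp
    obtain ⟨f, hfs, hf⟩ := (hmem u s hs A).1 hA
    obtain ⟨g, hgt, hg⟩ := (hmem v t ht B).1 hB
    obtain ⟨C, hCU, hCf, hCg⟩ := exists_mem_submodule_eval_ne_zero (U.map W.subtype) f g hAU hBU hf hg
    exact ⟨⟨C, hSZ U C hCU⟩, hCU, (hmem u s hs _).2 ⟨f, hfs, hCf⟩, (hmem v t ht _).2 ⟨g, hgt, hCg⟩⟩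
  -- The dimension of `W` is the length of a longest chain of subspaces, and these are irreducible
  -- closed sets.
  have hlen : (Module.finrank K W : WithBot ℕ∞) = Order.krullDim (Submodule K W) := by
    rw [← Module.coe_length, Module.length_eq_finrank]
    rfl
  rw [hlen]
  refine Order.krullDim_le_of_strictMono (β := TopologicalSpace.IrreducibleCloseds Z)
    (fun U => ⟨S U, hirr U, hclosed U⟩) (Monotone.strictMono_of_injective ?_ ?_)
  · intro U V hUV A hA
    exact Submodule.map_mono hUV hA
  · intro U V hUV
    have h : S U = S V := congrArg TopologicalSpace.IrreducibleCloseds.carrier hUV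
    ext x
    have hx := Set.ext_iff.1 h ⟨x.1, hW x.2⟩
    simpa [S] using hx

/-! ### Vectors with entries in an algebra with few generators -/

/-- The vectors of the family `x` with index in `J` have all their entries in a `K`-algebra
generated by `n` elements. -/
def EntriesGeneratedBy (K : Type*) {L ι : Type*} [Field K] [Field L] [Algebra K L] {P : ℕ}
    (x : ι → Fin P → L) (J : Finset ι) (n : ℕ) : Prop :=
  ∃ T : Finset L, T.card ≤ n ∧ ∀ j ∈ J, ∀ i, x j i ∈ Algebra.adjoin K (T : Set L)

namespace EntriesGeneratedBy

variable {K L ι : Type*} [Field K] [Field L] [Algebra K L] {P : ℕ} {x : ι → Fin P → L}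
  {J J' : Finset ι} {n n' : ℕ}

theorem mono (h : EntriesGeneratedBy K x J n) (hJ : J' ⊆ J) (hn : n ≤ n') :
    EntriesGeneratedBy K x J' n' :=
  let ⟨T, hT, hx⟩ := h
  ⟨T, hT.trans hn, fun j hj => hx j (hJ hj)⟩

theorem empty : EntriesGeneratedBy K x ∅ 0 := ⟨∅, by simp⟩

theorem union [DecidableEq ι] (h : EntriesGeneratedBy K x J n) (J' : Finset ι) :
    EntriesGeneratedBy K x (J ∪ J') (n + P * J'.card) := by
  classical
  obtain ⟨T, hT, hx⟩ := h
  refine ⟨T ∪ (J' ×ˢ Finset.univ).image fun s : ι × Fin P => x s.1 s.2, ?_, ?_⟩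
  · refine (Finset.card_union_le _ _).trans (add_le_add hT (Finset.card_image_le.trans ?_))
    simp [mul_comm]
  · intro j hj i
    rcases Finset.mem_union.1 hj with hj | hj
    · exact Algebra.adjoin_mono (by simp) (hx j hj i)
    · refine Algebra.subset_adjoin ?_
      simp only [Finset.coe_union, Set.mem_union, Finset.mem_coe, Finset.mem_image]
      exact Or.inr ⟨(j, i), by simpa using hj, rfl⟩

theorem of_card [DecidableEq ι] (J : Finset ι) : EntriesGeneratedBy K x J (P * J.card) := by
  simpa using (empty (K := K) (x := x)).union J

/-- A vector that is, up to a `K`-combination of the given vectors, an `L`-combination of `r` of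
them, costs at most `r` further generators. -/
theorem insert_of_mem_span [DecidableEq ι] (h : EntriesGeneratedBy K x J n) {J₀ : Finset ι}
    (hJ₀ : J₀ ⊆ J) {j : ι} {y : Fin P → L} (hy : y ∈ Submodule.span K (x '' J))
    (hj : x j + y ∈ Submodule.span L (x '' J₀)) :
    EntriesGeneratedBy K x (insert j J) (n + J₀.card) := by
  classical
  obtain ⟨T, hT, hx⟩ := h
  obtain ⟨c, hc⟩ := (Submodule.mem_span_image_finset_iff_exists_fun L).1 hj
  -- Only the coefficients `c` are new: `y` is `K`-linear in the old entries.
  refine ⟨T ∪ Finset.univ.image c, ?_, ?_⟩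
  · refine (Finset.card_union_le _ _).trans (add_le_add hT (Finset.card_image_le.trans ?_))
    simp
  · have hold : ∀ j ∈ J, ∀ i, x j i ∈ Algebra.adjoin K ((T ∪ Finset.univ.image c : Finset L) : Set L) :=
      fun j hj i => Algebra.adjoin_mono (by simp) (hx j hj i)
    have hyi : ∀ i, y i ∈ Algebra.adjoin K ((T ∪ Finset.univ.image c : Finset L) : Set L) := by
      refine Submodule.span_induction ?_ ?_ ?_ ?_ hy
      · rintro _ ⟨j, hj, rfl⟩
        exact hold j hj
      · intro i
        exact zero_mem _
      · intro u v _ _ hu hv i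
        exact add_mem (hu i) (hv i)
      · intro a u _ hu i
        exact Subalgebra.smul_mem _ (hu i) a
    intro j' hj' i
    rcases Finset.mem_insert.1 hj' with rfl | hj'
    · have hxi : x j' i = (∑ s : J₀, c s * x s i) - y i := by
        rw [eq_sub_iff_add_eq, ← Pi.add_apply, ← hc]
        simp [Finset.sum_apply]
      rw [hxi]
      refine sub_mem (sum_mem fun s _ => mul_mem (Algebra.subset_adjoin ?_) (hold s (hJ₀ s.2) i))
        (hyi i)
      simp
    · exact hold j' hj' i

end EntriesGeneratedBy

/-! ### Linear dependence of modified families -/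

/-- The vectors off `ρ` stay independent, so only the new vector can create a dependence. -/
theorem mem_span_image_compl_of_not_linearIndependent_update {F V ι : Type*} [Field F]
    [AddCommGroup V] [Module F V] [DecidableEq ι] {u : ι → V} (hu : LinearIndependent F u)
    {ρ : ι} {w : V} (h : ¬ LinearIndependent F (Function.update u ρ w)) :
    w ∈ Submodule.span F (u '' {ρ}ᶜ) := by
  by_contra hw
  apply h
  have h1 : LinearIndepOn F (Function.update u ρ w) {ρ}ᶜ :=
    (hu.linearIndepOn _).congr fun j hj => (Function.update_of_ne hj _ _).symm
  have himg : Function.update u ρ w '' {ρ}ᶜ = u '' {ρ}ᶜ :=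
    Set.image_congr fun j hj => Function.update_of_ne hj _ _
  have h2 := h1.insert (x := ρ) (by rwa [himg, Function.update_self])
  rwa [Set.insert_eq, Set.union_compl_self, linearIndepOn_univ_iff] at h2

/-- If adding `B` to any one of the vectors `u ρ`, `ρ ∈ S`, makes an independent family dependent,
then all these vectors have coefficient `-1` in `B`. -/
theorem add_sum_mem_span_image_compl {F V ι : Type*} [Field F] [AddCommGroup V] [Module F V]
    [Fintype ι] [DecidableEq ι] {u : ι → V} (hu : LinearIndependent F u) {B : V} {S : Finset ι}
    (hS : S.Nonempty)
    (h : ∀ ρ ∈ S, ¬ LinearIndependent F (Function.update u ρ (u ρ + B))) :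
    B + ∑ ρ ∈ S, u ρ ∈ Submodule.span F (u '' (S : Set ι)ᶜ) := by
  obtain ⟨ρ₀, hρ₀⟩ := hS
  have hmem := fun ρ hρ => mem_span_image_compl_of_not_linearIndependent_update hu (h ρ hρ)
  have hB : B ∈ Submodule.span F (Set.range u) := by
    have h1 := Submodule.span_mono (Set.image_subset_range u _) (hmem ρ₀ hρ₀)
    exact (Submodule.add_mem_iff_right _ (Submodule.subset_span (Set.mem_range_self ρ₀))).1 h1
  obtain ⟨c, rfl⟩ := (Submodule.mem_span_range_iff_exists_fun F).1 hB
  -- Modulo the other vectors, `u ρ + B` is `(1 + c ρ) • u ρ`; a nonzero factor would put `u ρ` in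
  -- their span.
  have hc : ∀ ρ ∈ S, 1 + c ρ = 0 := by
    intro ρ hρ
    by_contra hne
    have h1 := hmem ρ hρ
    rw [← Finset.add_sum_erase _ _ (Finset.mem_univ ρ), ← add_assoc] at h1
    have h2 : ∑ j ∈ Finset.univ.erase ρ, c j • u j ∈ Submodule.span F (u '' {ρ}ᶜ) :=
      sum_mem fun j hj => Submodule.smul_mem _ _
        (Submodule.subset_span ⟨j, Finset.ne_of_mem_erase hj, rfl⟩)
    have h3 := (Submodule.add_mem_iff_left _ h2).1 h1
    rw [show u ρ + c ρ • u ρ = (1 + c ρ) • u ρ by rw [add_smul, one_smul],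
      Submodule.smul_mem_iff _ hne, Set.compl_eq_univ_sdiff] at h3
    exact linearIndependent_iff_notMem_span.1 hu ρ h3
  rw [← Finset.sum_add_sum_compl S, add_right_comm, ← Finset.sum_add_distrib]
  rw [Finset.sum_eq_zero (s := S), zero_add]
  · refine sum_mem fun j hj => Submodule.smul_mem _ _ (Submodule.subset_span ⟨j, ?_, rfl⟩)
    simpa using hj
  · intro ρ hρ
    rw [show c ρ • u ρ + u ρ = (1 + c ρ) • u ρ by rw [add_smul, one_smul, add_comm], hc ρ hρ,
      zero_smul]

/-- If adding the vectors `x (f m)`, `m ∈ [i, n)`, to an independent family makes it dependent, then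
one of them is a combination of the later ones and of the family. -/
theorem exists_mem_span_of_not_linearIndepOn_union {F V ι : Type*} [Field F] [AddCommGroup V]
    [Module F V] (x : ι → V) (f : ℕ → ι) (R : Set ι) (hR : LinearIndepOn F x R) (i n : ℕ)
    (h : ¬ LinearIndepOn F x (f '' Set.Ico i n ∪ R)) :
    ∃ m, i ≤ m ∧ m < n ∧ x (f m) ∈ Submodule.span F (x '' (f '' Set.Ico (m + 1) n ∪ R)) := by
  by_contra! hcon
  apply h
  rcases le_total n i with hin | hin
  · simpa [Set.Ico_eq_empty_of_le hin] using hR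
  · induction hin using Nat.decreasingInduction with
    | self => simpa using hR
    | of_succ m hm ih =>
      have h1 : LinearIndepOn F x (f '' Set.Ico (m + 1) n ∪ R) := by
        by_contra h2
        exact h2 (ih h2 fun j hj => hcon j (by omega))
      have h3 := h1.insert (hcon m le_rfl hm)
      rwa [← Set.insert_union, ← Set.image_insert_eq, Set.insert_Ico_add_one_left_eq_Ico hm] at h3

/-! ### Staircases of vectors -/

section Staircase

variable {K L : Type*} [Field K] [Field L] [Algebra K L] {P : ℕ}

/-- For vectors `x (inl j) = α_j` and `x (inr j) = α_j + β_j`, the family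
`α_0 + β_0, …, α_{t-1} + β_{t-1}, α_t, …, α_{N-1}`. -/
def staircase {V : Type*} (x : ℕ ⊕ ℕ → V) (N t : ℕ) : Fin N → V := fun j =>
  if (j : ℕ) < t then x (Sum.inr j) else x (Sum.inl j)

/-- The part of a staircase that is not affected by later moves. -/
def fixedIndices (N k t : ℕ) : Finset (ℕ ⊕ ℕ) :=
  (Finset.Ico (k + 1) N).disjSum (Finset.range t)

/-- The indices of the vectors that occur in the staircases from `t` on. -/
def laterIndices (N k t : ℕ) : Finset (ℕ ⊕ ℕ) :=
  (Finset.Ico t N).disjSum (Finset.range (k + 1))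

variable {N k t m : ℕ}

@[simp]
theorem inl_mem_fixedIndices {j : ℕ} : Sum.inl j ∈ fixedIndices N k t ↔ k + 1 ≤ j ∧ j < N := by
  simp [fixedIndices]

@[simp]
theorem inr_mem_fixedIndices {j : ℕ} : Sum.inr j ∈ fixedIndices N k t ↔ j < t := by
  simp [fixedIndices]

@[simp]
theorem inl_mem_laterIndices {j : ℕ} : Sum.inl j ∈ laterIndices N k t ↔ t ≤ j ∧ j < N := by
  simp [laterIndices]

@[simp]
theorem inr_mem_laterIndices {j : ℕ} : Sum.inr j ∈ laterIndices N k t ↔ j < k + 1 := by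
  simp [laterIndices]

theorem card_fixedIndices : (fixedIndices N k t).card = N - (k + 1) + t := by
  simp [fixedIndices]

theorem card_laterIndices : (laterIndices N k t).card = N - t + (k + 1) := by
  simp [laterIndices]

theorem fixedIndices_subset_laterIndices (ht : t ≤ k) :
    fixedIndices N k t ⊆ laterIndices N k t := by
  rintro (j | j) hj <;> simp at hj ⊢ <;> omega

theorem linearIndependent_staircase {F V : Type*} [Field F] [AddCommGroup V] [Module F V]
    (x : ℕ ⊕ ℕ → V)
    (h : LinearIndepOn F x (Sum.inl '' Set.Ico t (k + 1) ∪ (fixedIndices N k t : Set (ℕ ⊕ ℕ)))) :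
    LinearIndependent F (staircase x N t) := by
  let σ : Fin N → ℕ ⊕ ℕ := fun j => if (j : ℕ) < t then Sum.inr j else Sum.inl j
  have hσ : ∀ j, σ j ∈ Sum.inl '' Set.Ico t (k + 1) ∪ (fixedIndices N k t : Set (ℕ ⊕ ℕ)) := by
    intro j
    by_cases hj : (j : ℕ) < t
    · simp [σ, hj]
    · have := j.2
      simp [σ, hj]
      omega
  have hinj : Function.Injective fun j => (⟨σ j, hσ j⟩ : ↥(Sum.inl '' Set.Ico t (k + 1) ∪
      (fixedIndices N k t : Set (ℕ ⊕ ℕ)))) := by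
    intro i j hij
    have hij' : σ i = σ j := congrArg Subtype.val hij
    simp only [σ] at hij'
    split_ifs at hij' <;> simp at hij' <;> omega
  convert h.linearIndependent.comp _ hinj using 1
  funext j
  simp only [staircase, σ, Function.comp]
  split_ifs <;> rfl

/-- If the staircase is independent, the rank conditions force the sum of the remaining moved
vectors into the span of the fixed part. -/
theorem sum_mem_span_fixedIndices {F V : Type*} [Field F] [AddCommGroup V] [Module F V]
    (x : ℕ ⊕ ℕ → V) (ht : t ≤ k) (hk : k + 1 ≤ N)
    (hu : LinearIndependent F (staircase x N t))
    (h : ∀ ρ : Fin N, t ≤ ρ → ρ ≤ k → ¬ LinearIndependent F (Function.update (staircase x N t) ρ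
      (staircase x N t ρ + ∑ j ∈ Finset.Ico t (k + 1), (x (Sum.inr j) - x (Sum.inl j))))) :
    ∑ j ∈ Finset.Ico t (k + 1), x (Sum.inr j) ∈
      Submodule.span F (x '' (fixedIndices N k t : Set (ℕ ⊕ ℕ))) := by
  let S : Finset (Fin N) := Finset.univ.filter fun ρ : Fin N => t ≤ (ρ : ℕ) ∧ (ρ : ℕ) ≤ k
  have hS : S.Nonempty := ⟨⟨t, by omega⟩, by simp [S, ht]⟩
  have h1 := add_sum_mem_span_image_compl hu hS (fun ρ hρ => by
    simp only [S, Finset.mem_filter] at hρ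
    exact h ρ hρ.2.1 hρ.2.2)
  have h2 : ∑ ρ ∈ S, staircase x N t ρ = ∑ j ∈ Finset.Ico t (k + 1), x (Sum.inl j) := by
    refine Finset.sum_bij (fun ρ _ => (ρ : ℕ)) ?_ ?_ ?_ ?_
    · intro ρ hρ
      simp only [S, Finset.mem_filter] at hρ
      simp
      omega
    · intro a _ b _ hab
      exact Fin.ext hab
    · intro j hj
      simp only [Finset.mem_Ico] at hj
      exact ⟨⟨j, by omega⟩, by simp [S]; omega, rfl⟩
    · intro ρ hρ
      simp only [S, Finset.mem_filter] at hρ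
      simp only [staircase]
      rw [if_neg (by omega)]
  -- The correction terms cancel the α_j in the sum of the β_j = γ_j - α_j, leaving the sum of the
  -- γ_j.
  rw [h2, Finset.sum_sub_distrib, sub_add_cancel] at h1
  refine Submodule.span_mono ?_ h1
  rintro _ ⟨j, hj, rfl⟩
  have hj' : ¬ (t ≤ (j : ℕ) ∧ (j : ℕ) ≤ k) := by simpa [S] using hj
  by_cases hjt : (j : ℕ) < t
  · exact ⟨Sum.inr j, by simpa using hjt, by simp [staircase, hjt]⟩
  · refine ⟨Sum.inl j, ?_, by simp [staircase, hjt]⟩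
    have := j.2
    simp
    omega

/-- One relation suffices for the count: every vector but `s` is paid for in full, and `s` costs
only its coefficients over `J₀`. -/
theorem entriesGeneratedBy_laterIndices_of_mem_span (x : ℕ ⊕ ℕ → Fin P → L)
    {s : ℕ ⊕ ℕ} (hs : s ∈ laterIndices N k t) (htk : t ≤ k) (hk : k + 1 ≤ N)
    {J₀ : Finset (ℕ ⊕ ℕ)} (hJ₀ : J₀ ⊆ (laterIndices N k t).erase s)
    (hcard : J₀.card ≤ N - (k + 1) + t) {y : Fin P → L}
    (hy : y ∈ Submodule.span K (x '' ((laterIndices N k t).erase s : Finset (ℕ ⊕ ℕ))))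
    (hsy : x s + y ∈ Submodule.span L (x '' J₀)) :
    EntriesGeneratedBy K x (laterIndices N k t) (P * (k + N - t) + (N - (k + 1) + t)) := by
  have h1 := (EntriesGeneratedBy.of_card (K := K) (x := x)
    ((laterIndices N k t).erase s)).insert_of_mem_span hJ₀ hy hsy
  rw [Finset.insert_erase hs, Finset.card_erase_of_mem hs, card_laterIndices,
    show N - t + (k + 1) - 1 = k + N - t by omega] at h1
  exact h1.mono subset_rfl (by omega)

/-- The rank conditions for the staircases from `t` on cost `P - N + k + 1 - t` parameters. -/
theorem entriesGeneratedBy_laterIndices (x : ℕ ⊕ ℕ → Fin P → L) (hk : k + 1 ≤ N) (hN : N ≤ P)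
    (h : ∀ t : ℕ, ∀ ρ : Fin N, t ≤ ρ → ρ ≤ k → ¬ LinearIndependent L
      (Function.update (staircase x N t) ρ (staircase x N t ρ +
        ∑ j ∈ Finset.Ico t (k + 1), (x (Sum.inr j) - x (Sum.inl j)))))
    (t : ℕ) (ht : t ≤ k) :
    EntriesGeneratedBy K x (laterIndices N k t) (P * (k + N - t) + (N - (k + 1) + t)) := by
  induction hd : k - t using Nat.strong_induction_on generalizing t with
  | _ d ih =>
  subst hd
  by_cases hR : LinearIndepOn L x (fixedIndices N k t : Set (ℕ ⊕ ℕ))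
  swap
  · rw [linearIndepOn_iff_notMem_span] at hR
    push Not at hR
    obtain ⟨s, hs, hspan⟩ := hR
    have hs' : s ∈ fixedIndices N k t := hs
    refine entriesGeneratedBy_laterIndices_of_mem_span (K := K) x
      (fixedIndices_subset_laterIndices ht hs') ht hk
      (J₀ := (fixedIndices N k t).erase s)
      (Finset.erase_subset_erase _ (fixedIndices_subset_laterIndices ht)) ?_
      (Submodule.zero_mem _) ?_
    · rw [Finset.card_erase_of_mem hs', card_fixedIndices]
      omega
    · rwa [add_zero, Finset.coe_erase]
  by_cases hu : LinearIndepOn L x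
    (Sum.inl '' Set.Ico t (k + 1) ∪ (fixedIndices N k t : Set (ℕ ⊕ ℕ)))
  · have h1 := sum_mem_span_fixedIndices x ht hk (linearIndependent_staircase x hu) (h t)
    -- Isolate γ_k; the other γ_j of the sum have coefficient 1 in `K`, hence are free.
    rw [Finset.sum_Ico_succ_top ht, add_comm] at h1
    refine entriesGeneratedBy_laterIndices_of_mem_span (K := K) x (s := Sum.inr k) (by simp) ht hk
      ?_ card_fixedIndices.le ?_ h1
    · rw [Finset.subset_erase]
      exact ⟨fixedIndices_subset_laterIndices ht, by simp; omega⟩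
    · refine sum_mem fun j hj => Submodule.subset_span ⟨Sum.inr j, ?_, rfl⟩
      simp only [Finset.mem_Ico] at hj
      simp
      omega
  · obtain ⟨m, htm, hmk, hm⟩ := exists_mem_span_of_not_linearIndepOn_union x Sum.inl _ hR _ _ hu
    let J₀ : Finset (ℕ ⊕ ℕ) := (Finset.Ico (m + 1) N).disjSum (Finset.range t)
    have hJ₀ : (Sum.inl '' Set.Ico (m + 1) (k + 1) ∪ (fixedIndices N k t : Set (ℕ ⊕ ℕ))) =
        (J₀ : Set (ℕ ⊕ ℕ)) := by
      ext (j | j)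
      · simp [J₀]
        omega
      · simp [J₀]
    have hJ₀card : J₀.card = N - (m + 1) + t := by simp [J₀]
    rw [hJ₀] at hm
    rcases Nat.lt_succ_iff_lt_or_eq.1 hmk with hmk | rfl
    · have h1 := ih (k - (m + 1)) (by omega) (m + 1) (by omega) rfl
      have hsub : J₀ ⊆ laterIndices N k (m + 1) := by
        rintro (j | j) hj <;> simp [J₀] at hj ⊢ <;> omega
      have h2 := (h1.insert_of_mem_span hsub (j := Sum.inl m) (y := 0) (Submodule.zero_mem _)
        (by rwa [add_zero])).union ((Finset.Ico t m).map Function.Embedding.inl)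
      refine h2.mono ?_ ?_
      · rintro (j | j) hj <;> simp at hj ⊢ <;> omega
      · rw [hJ₀card, Finset.card_map, Nat.card_Ico]
        -- The surpluses N - (k+1) + (m+1) from stage m + 1 and N - (m+1) + t for α_m add up to N
        -- more than the allowed N - (k+1) + t. Since N ≤ P, the P entries saved on α_m cover the
        -- excess.
        rw [show k + N - t = k + N - (m + 1) + (m - t) + 1 by omega, mul_add, mul_add, mul_one]
        omega
    · refine entriesGeneratedBy_laterIndices_of_mem_span (K := K) x (s := Sum.inl m) (J₀ := J₀)
        (by simp; omega) ht hk ?_ hJ₀card.le (Submodule.zero_mem _) (by rwa [add_zero])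
      rintro (j | j) hj <;> simp [J₀] at hj ⊢ <;> omega

end Staircase

/-! ### Moved families -/

section MovedFamily

theorem movedFamily_map {V W : Type*} [AddCommGroup V] [AddCommGroup W] (f : V →+ W) {a b : ℕ}
    (α : Fin a → V) (β : Fin b → V) (t ρ : ℕ) (j : Fin a) :
    f (movedFamily α β t ρ j) = movedFamily (fun j => f (α j)) (fun j => f (β j)) t ρ j := by
  unfold movedFamily
  split_ifs <;> simp [apply_ite f, *]

theorem movedFamily_eq_add {V : Type*} [AddCommGroup V] {a b : ℕ} (α : Fin a → V) (β : Fin b → V)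
    {t ρ : ℕ} (h : t ≤ ρ) (j : Fin a) :
    movedFamily α β t ρ j = α j +
      ((if (j : ℕ) < t then (if h : (j : ℕ) < b then β ⟨j, h⟩ else 0) else 0) +
        if (j : ℕ) = ρ then ∑ i : Fin b, (if t ≤ (i : ℕ) then β i else 0) else 0) := by
  unfold movedFamily
  split_ifs <;> first | omega | simp

/-- Moving the coefficients does not change the sum of all vectors. -/
theorem sum_movedFamily {V : Type*} [AddCommGroup V] {q : ℕ} (α β : Fin q → V)
    {t ρ : ℕ} (h : t ≤ ρ) (hρ : ρ < q) :
    ∑ j, movedFamily α β t ρ j = ∑ j, α j + ∑ j, β j := by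
  simp only [movedFamily_eq_add α β h, Finset.sum_add_distrib]
  congr 1
  have h1 : ∑ j : Fin q, (if (j : ℕ) = ρ then ∑ i : Fin q, (if t ≤ (i : ℕ) then β i else 0) else 0)
      = ∑ i : Fin q, (if t ≤ (i : ℕ) then β i else 0) := by
    rw [Finset.sum_eq_single (⟨ρ, hρ⟩ : Fin q)]
    · simp
    · intro b _ hb
      exact if_neg fun h => hb (Fin.ext h)
    · simp
  rw [h1, ← Finset.sum_add_distrib]
  refine Finset.sum_congr rfl fun j _ => ?_
  rw [dif_pos j.2]
  split_ifs <;> first | omega | simp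

theorem vrank_le_sub_one_iff {K V : Type*} [Field K] [AddCommGroup V] [Module K V] {q : ℕ}
    (hq : 1 ≤ q) (v : Fin q → V) : vrank K v ≤ q - 1 ↔ ¬ LinearIndependent K v := by
  rw [linearIndependent_iff_card_le_finrank_span, Fintype.card_fin]
  change Set.finrank K (Set.range v) ≤ q - 1 ↔ _
  omega

variable {K L : Type*} [Field K] [Field L] [Algebra K L] {P N k : ℕ}

/-- If all moved families are dependent, the entries of the vectors lie in an algebra with
`P - N + k + 1` generators fewer than the number of entries. -/
theorem exists_generators_of_movedFamily (hk : k + 1 ≤ N) (hN : N ≤ P) (α : Fin N → Fin P → L)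
    (β : Fin (k + 1) → Fin P → L)
    (h : ∀ t ρ : ℕ, t ≤ ρ → ρ ≤ k → ¬ LinearIndependent L (movedFamily α β t ρ)) :
    ∃ T : Finset L, T.card ≤ P * (k + N) + (N - (k + 1)) ∧
      (∀ j i, α j i ∈ Algebra.adjoin K (T : Set L)) ∧
        ∀ j i, β j i ∈ Algebra.adjoin K (T : Set L) := by
  -- The zeros are fillers: every index used is below `N`, respectively `k + 1`.
  let x : ℕ ⊕ ℕ → Fin P → L := Sum.elim (fun j => if h : j < N then α ⟨j, h⟩ else 0)
    (fun j => if h : j < k + 1 then α ⟨j, by omega⟩ + β ⟨j, h⟩ else 0)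
  have hxα : ∀ j : Fin N, x (Sum.inl j) = α j := fun j => by simp [x]
  have hxβ : ∀ j : Fin (k + 1), x (Sum.inr j) - x (Sum.inl j) = β j := fun j => by
    have : (j : ℕ) < N := by omega
    have hj : (j : ℕ) < k + 1 := j.2
    simp [x, this, Nat.lt_succ_iff.1 hj]
  have hsum : ∀ t, ∑ i : Fin (k + 1), (if t ≤ (i : ℕ) then β i else 0) =
      ∑ j ∈ Finset.Ico t (k + 1), (x (Sum.inr j) - x (Sum.inl j)) := by
    intro t
    simp only [← hxβ]
    rw [Fin.sum_univ_eq_sum_range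
      (fun j => if t ≤ j then x (Sum.inr j) - x (Sum.inl j) else 0) (k + 1), ← Finset.sum_filter]
    refine Finset.sum_congr ?_ fun _ _ => rfl
    ext j
    simp
    omega
  have hmoved : ∀ t : ℕ, ∀ ρ : Fin N, t ≤ ρ → ρ ≤ k →
      Function.update (staircase x N t) ρ (staircase x N t ρ +
        ∑ j ∈ Finset.Ico t (k + 1), (x (Sum.inr j) - x (Sum.inl j))) = movedFamily α β t ρ := by
    intro t ρ htρ hρk
    funext j
    rw [← hsum]
    unfold movedFamily staircase
    by_cases hj : j = ρ
    · subst hj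
      rw [Function.update_self, if_neg (by omega), if_neg (by omega), if_pos rfl, hxα]
    · have hj' : (j : ℕ) ≠ ρ := fun h => hj (Fin.ext h)
      rw [Function.update_of_ne hj]
      by_cases hjt : (j : ℕ) < t
      · have hjk : (j : ℕ) < k + 1 := by omega
        rw [if_pos hjt, if_pos hjt, dif_pos hjk, ← hxβ ⟨j, hjk⟩, ← hxα j, add_sub_cancel]
      · rw [if_neg hjt, if_neg hjt, if_neg hj', hxα]
  obtain ⟨T, hT, hmem⟩ := entriesGeneratedBy_laterIndices (K := K) x hk hN
    (fun t ρ htρ hρk => by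
      rw [hmoved t ρ htρ hρk]
      exact h t ρ htρ hρk) 0 (Nat.zero_le k)
  refine ⟨T, by simpa using hT, fun j i => ?_, fun j i => ?_⟩
  · rw [← hxα]
    exact hmem _ (by simp) i
  · rw [← hxβ]
    exact sub_mem (hmem (Sum.inr j) (by simp; omega) i) (hmem (Sum.inl j) (by simp; omega) i)

end MovedFamily

/-! ### Linear dependence at generic points -/

/-- Row rank equals column rank, so `N` independent columns can be selected. Independence thus
becomes nonvanishing of a maximal minor, a polynomial condition that transfers to generic points. -/
theorem exists_det_ne_zero_of_linearIndependent {F : Type*} [Field F] {N P : ℕ}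
    {v : Fin N → Fin P → F} (hv : LinearIndependent F v) :
    ∃ e : Fin N → Fin P, (Matrix.of fun i j => v i (e j)).det ≠ 0 := by
  have hrank : (Matrix.of v).rank = N := by
    simpa using LinearIndependent.rank_matrix (M := Matrix.of v) hv
  rw [Matrix.rank_eq_finrank_span_cols] at hrank
  obtain ⟨f, hf, -, hind⟩ := Submodule.exists_fun_fin_finrank_span_eq F (Set.range (Matrix.of v).col)
  choose e he using hf
  let c := finCongr hrank.symm
  refine ⟨fun j => e (c j), ?_⟩
  have hcol : LinearIndependent F (Matrix.of fun i j => v i (e (c j))).col := by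
    have h : (Matrix.of fun i j => v i (e (c j))).col = f ∘ c := funext fun j => he (c j)
    rw [h]
    exact hind.comp c c.injective
  exact ((Matrix.isUnit_iff_isUnit_det _).1
    (Matrix.linearIndependent_cols_iff_isUnit.1 hcol)).ne_zero

theorem linearIndependent_of_det_ne_zero {F : Type*} [Field F] {N P : ℕ}
    {v : Fin N → Fin P → F} {e : Fin N → Fin P}
    (h : (Matrix.of fun i j => v i (e j)).det ≠ 0) : LinearIndependent F v := by
  have h1 : LinearIndependent F (Matrix.of fun i j => v i (e j)).row :=
    Matrix.linearIndependent_rows_of_det_ne_zero h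
  exact LinearIndependent.of_comp (LinearMap.funLeft F F e) h1

/-- Linear dependence of a family of vectors with polynomial entries passes from the points of a
set to the points of its Zariski closure over extension fields. -/
theorem not_linearIndependent_of_generic {K L σ : Type*} [Field K] [Field L] [Algebra K L]
    {N P : ℕ} (Z : Set (σ → K)) (x : σ → L)
    (hx : ∀ g : MvPolynomial σ K, (∀ A ∈ Z, MvPolynomial.eval A g = 0) → MvPolynomial.aeval x g = 0)
    (f : Fin N → Fin P → MvPolynomial σ K)
    (hZ : ∀ A ∈ Z, ¬ LinearIndependent K fun j i => MvPolynomial.eval A (f j i)) :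
    ¬ LinearIndependent L fun j i => MvPolynomial.aeval x (f j i) := by
  intro hind
  obtain ⟨e, he⟩ := exists_det_ne_zero_of_linearIndependent hind
  apply he
  have h1 := hx (Matrix.of fun i j => f i (e j)).det (fun A hA => by
    by_contra hne
    rw [RingHom.map_det] at hne
    exact hZ A hA (linearIndependent_of_det_ne_zero (e := e) hne))
  rw [AlgHom.map_det] at h1
  exact h1

/-! ### The codimensions of the varieties -/

section Codimension

theorem le_matCodim_of_matDim_le {K : Type*} [Field K] {m n : Type*} {Z : Set (Matrix m n K)}
    {d c : ℕ} (h : matDim Z ≤ d) (hc : d + c ≤ Nat.card (m × n)) : (c : ℕ∞) ≤ matCodim Z := by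
  unfold matCodim
  induction hZ : matDim Z with
  | bot => exact le_top
  | coe e =>
    rw [hZ] at h
    have he : e ≤ d := by exact_mod_cast h
    refine le_trans ?_ (tsub_le_tsub_left he _)
    rw [← ENat.natCast_sub, Nat.cast_le]
    omega

theorem matCodim_le_of_le_matDim {K : Type*} [Field K] {m n : Type*} {Z : Set (Matrix m n K)}
    {d c : ℕ} (h : (d : WithBot ℕ∞) ≤ matDim Z) (hc : Nat.card (m × n) ≤ d + c) :
    matCodim Z ≤ c := by
  unfold matCodim
  induction hZ : matDim Z with
  | bot =>
    rw [hZ, le_bot_iff] at h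
    exact absurd h (WithBot.coe_ne_bot (a := (d : ℕ∞)))
  | coe e =>
    rw [hZ] at h
    have he : (d : ℕ∞) ≤ e := by exact_mod_cast h
    refine (tsub_le_tsub_left he _).trans ?_
    rw [← ENat.natCast_sub, Nat.cast_le]
    omega

variable {K : Type u} [Field K]

theorem movedFamily_map_ringHom {R F : Type*} [CommRing R] [CommRing F] (φ : R →+* F) {P a b : ℕ}
    (α : Fin a → Fin P → R) (β : Fin b → Fin P → R) (t ρ : ℕ) :
    (fun j i => φ (movedFamily α β t ρ j i)) =
      movedFamily (fun j i => φ (α j i)) (fun j i => φ (β j i)) t ρ :=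
  funext fun j => movedFamily_map (φ.toAddMonoidHom.compLeft (Fin P)) α β t ρ j

/-- The dependence of moved families passes to generic points. -/
theorem not_linearIndependent_movedFamily_of_generic {L : Type*} [Field L] [Algebra K L]
    {P N b : ℕ} {ι : Type*} (Z : Set (Matrix (Fin P) (ι ⊕ Fin b) K)) (c : Fin N → ι)
    (x : Matrix (Fin P) (ι ⊕ Fin b) L)
    (hx : ∀ f : MvPolynomial (Fin P × (ι ⊕ Fin b)) K,
      (∀ A ∈ Z, MvPolynomial.eval (fun ij : Fin P × (ι ⊕ Fin b) => A ij.1 ij.2) f = 0) →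
        MvPolynomial.aeval (fun ij : Fin P × (ι ⊕ Fin b) => x ij.1 ij.2) f = 0)
    (t ρ : ℕ)
    (hZ : ∀ A ∈ Z, ¬ LinearIndependent K
      (movedFamily (fun j => A.col (Sum.inl (c j))) (fun j => A.col (Sum.inr j)) t ρ)) :
    ¬ LinearIndependent L
      (movedFamily (fun j => x.col (Sum.inl (c j))) (fun j => x.col (Sum.inr j)) t ρ) := by
  -- The moved family of the universal matrix; it specializes both to the points of `Z` and to `x`.
  let f : Fin N → Fin P → MvPolynomial (Fin P × (ι ⊕ Fin b)) K :=
    movedFamily (fun j i => MvPolynomial.X (i, Sum.inl (c j)))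
      (fun j i => MvPolynomial.X (i, Sum.inr j)) t ρ
  have h := not_linearIndependent_of_generic
    ((fun (A : Matrix (Fin P) (ι ⊕ Fin b) K) (ij : Fin P × (ι ⊕ Fin b)) => A ij.1 ij.2) '' Z)
    (fun ij => x ij.1 ij.2) (fun g hg => hx g fun A hA => hg _ ⟨A, hA, rfl⟩) f (by
      rintro _ ⟨A, hA, rfl⟩
      rw [movedFamily_map_ringHom]
      simp only [MvPolynomial.eval_X]
      exact hZ A hA)
  have hmap := movedFamily_map_ringHom (MvPolynomial.aeval (R := K)
    (fun ij : Fin P × (ι ⊕ Fin b) => x ij.1 ij.2)).toRingHom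
      (fun (j : Fin N) i => MvPolynomial.X (i, Sum.inl (c j)))
      (fun j i => MvPolynomial.X (i, Sum.inr j)) t ρ
  intro hind
  apply h
  refine hmap ▸ ?_
  simp only [AlgHom.toRingHom_eq_coe, RingHom.coe_coe, MvPolynomial.aeval_X]
  exact hind

/-- This is the generator count with N = k + 1 = q, where the surplus N - (k+1) vanishes. -/
theorem matDim_coreVariety_le {p q : ℕ} (hq : 1 ≤ q) (hqp : q ≤ p) (l : ℕ) :
    matDim (coreVariety K l p q) ≤ (p * (2 * q - 1) : ℕ) := by
  obtain ⟨k, rfl⟩ := Nat.exists_eq_add_of_le' hq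
  refine matDim_le_of_generic_points _ _ fun L _ _ x hx => ?_
  obtain ⟨T, hT, hα, hβ⟩ := exists_generators_of_movedFamily (K := K) le_rfl hqp
    (fun j => x.col (Sum.inl j)) (fun j => x.col (Sum.inr j)) (fun t ρ htρ hρ =>
      not_linearIndependent_movedFamily_of_generic _ id x hx t ρ (fun A hA => by
        rw [← vrank_le_sub_one_iff hq]
        rcases Nat.eq_zero_or_pos t with rfl | ht
        · exact hA.2.1 ρ (by omega)
        · exact hA.2.2 t ρ ht htρ (by omega)))
  refine ⟨T, hT.trans (le_of_eq ?_), fun i j => ?_⟩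
  · rw [show 2 * (k + 1) - 1 = k + (k + 1) by omega]
    simp
  · rcases j with j | j
    · exact hα j i
    · exact hβ j i

/-- The subspace of matrices with zero column sum is cut out by `p` linear equations, and on it
every moved family has the relation with all coefficients 1. -/
theorem le_matDim_coreVariety [Infinite K] {p q : ℕ} (hq : 1 ≤ q) :
    ((p * (2 * q - 1) : ℕ) : WithBot ℕ∞) ≤ matDim (coreVariety K q p q) := by
  let Φ : Matrix (Fin p) (Fin q ⊕ Fin q) K →ₗ[K] (Fin p → K) :=
    (Matrix.mulVecBilin K K).flip fun _ => 1
  have hΦ : ∀ A ∈ LinearMap.ker Φ,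
      ∑ j : Fin q, A.col (Sum.inl j) + ∑ j : Fin q, A.col (Sum.inr j) = 0 := by
    intro A hA
    have h : Φ A = 0 := hA
    rw [← h]
    funext i
    simp [Φ, Matrix.mulVec, dotProduct, Finset.sum_apply]
  have hsub : (LinearMap.ker Φ : Set (Matrix (Fin p) (Fin q ⊕ Fin q) K)) ⊆ coreVariety K q p q := by
    intro A hA
    have hdep : ∀ t ρ, t ≤ ρ → ρ < q → vrank K (movedFamily (fun j : Fin q => A.col (Sum.inl j))
        (fun j : Fin q => A.col (Sum.inr j)) t ρ) ≤ q - 1 := by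
      intro t ρ htρ hρ
      rw [vrank_le_sub_one_iff hq, Fintype.not_linearIndependent_iff]
      refine ⟨fun _ => 1, ?_, ⟨0, hq⟩, one_ne_zero⟩
      simp only [one_smul]
      rw [sum_movedFamily _ _ htρ hρ, hΦ A hA]
    refine ⟨?_, fun ν hν => hdep 0 ν (Nat.zero_le _) hν, fun t ρ _ htρ hρ => hdep t ρ htρ hρ⟩
    simpa [vrank, Set.finrank] using
      finrank_range_le_card (R := K) (fun j : Fin q => A.col (Sum.inl j))
  refine le_trans ?_ (finrank_le_matDim _ _ hsub)
  have h1 := LinearMap.finrank_range_add_finrank_ker Φ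
  have h2 := Submodule.finrank_le (LinearMap.range Φ)
  rw [Module.finrank_matrix] at h1
  simp only [Module.finrank_fin_fun, Fintype.card_fin, Fintype.card_sum, Module.finrank_self,
    mul_one] at h1 h2
  have h3 : p * (2 * q - 1) ≤ Module.finrank K (LinearMap.ker Φ) := by
    rw [Nat.mul_sub, mul_one, two_mul]
    omega
  exact_mod_cast h3

/-- The rank condition on the `α_j` being void, the codimension of the variety is `p`. -/
theorem coreCodim_self [Infinite K] {p q : ℕ} (hq : 1 ≤ q) (hqp : q ≤ p) :
    coreCodim K q p q = p := by
  have hcard : Nat.card (Fin p × (Fin q ⊕ Fin q)) = p * (2 * q - 1) + p := by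
    simp only [Nat.card_prod, Nat.card_sum, Nat.card_fin]
    rw [← Nat.mul_succ]
    congr 1
    omega
  exact le_antisymm (matCodim_le_of_le_matDim (le_matDim_coreVariety hq) hcard.le)
    (le_matCodim_of_matDim_le (matDim_coreVariety_le hq hqp q) hcard.ge)

/-- Without α_N, each moved family has N vectors in a space of dimension at most N - 1, so the
generator count applies. The column-sum relation holds at generic points too and recovers α_N
without new generators. -/
theorem matDim_movingVariety_le {P N k : ℕ} (hk : k + 1 ≤ N) (hN : N ≤ P) :
    matDim (movingVariety K P N k) ≤ (P * (k + N) + (N - (k + 1)) : ℕ) := by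
  refine matDim_le_of_generic_points _ _ fun L _ _ x hx => ?_
  obtain ⟨T, hT, hα, hβ⟩ := exists_generators_of_movedFamily (K := K) hk hN
    (fun j => x.col (Sum.inl j.castSucc)) (fun j => x.col (Sum.inr j)) (fun t ρ htρ hρ =>
      not_linearIndependent_movedFamily_of_generic _ Fin.castSucc x hx t ρ (fun A hA hind => by
        have hr : vrank K (movedFamily (fun j : Fin (N + 1) => A.col (Sum.inl j))
            (fun j : Fin (k + 1) => A.col (Sum.inr j)) t ρ) ≤ N - 1 := by
          rcases Nat.eq_zero_or_pos t with rfl | ht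
          · exact hA.2.1 ρ hρ
          · exact hA.2.2 t ρ ht htρ hρ
        have h1 := finrank_span_eq_card hind
        rw [Fintype.card_fin] at h1
        have h2 : Module.finrank K (Submodule.span K (Set.range
            (movedFamily (fun j : Fin N => A.col (Sum.inl j.castSucc))
              (fun j : Fin (k + 1) => A.col (Sum.inr j)) t ρ))) ≤ N - 1 := by
          refine le_trans (Submodule.finrank_mono (Submodule.span_mono ?_)) hr
          rintro _ ⟨j, rfl⟩
          exact ⟨j.castSucc, rfl⟩
        omega))
  refine ⟨T, hT, fun i j => ?_⟩
  rcases j with j | j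
  · refine Fin.lastCases ?_ (fun j => hα j i) j
    have h := hx (∑ j : Fin (N + 1), MvPolynomial.X (i, Sum.inl j) +
      ∑ j : Fin (k + 1), MvPolynomial.X (i, Sum.inr j)) (fun A hA => by
        have := congrFun hA.1 i
        simpa [Finset.sum_apply, Matrix.col] using this)
    simp only [map_add, map_sum, MvPolynomial.aeval_X] at h
    rw [Fin.sum_univ_castSucc, add_right_comm, add_comm] at h
    rw [eq_neg_of_add_eq_zero_left h]
    exact neg_mem (add_mem (sum_mem fun j _ => hα j i) (sum_mem fun j _ => hβ j i))
  · exact hβ j i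

end Codimension

theorem mainTheorem10 (K : Type*) [Field K] [IsAlgClosed K] (N c r k : ℕ) (hN : 3 ≤ N)
    (hcr : N ≤ 2 * c + r) (hk : 1 ≤ k) (hkN : k ≤ N - 1) :
    coreCodim K (k + 1) (2 * c + r - N + k + 1) (k + 1) + ((2 * c + r : ℕ) : ℕ∞)
        ≤ matCodim (movingVariety K (2 * c + r) N k) ∧
      ((2 * (2 * c + r) - N + k + 1 : ℕ) : ℕ∞)
        ≤ coreCodim K (k + 1) (2 * c + r - N + k + 1) (k + 1) + ((2 * c + r : ℕ) : ℕ∞) := by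
  have : Infinite K := IsAlgClosed.instInfinite
  rw [coreCodim_self (by omega) (by omega), ← Nat.cast_add]
  generalize 2 * c + r = P at *
  refine ⟨le_matCodim_of_matDim_le (matDim_movingVariety_le (by omega) hcr) ?_, ?_⟩
  · simp only [Nat.card_prod, Nat.card_sum, Nat.card_fin]
    -- The 2P entries beyond P(k+N), less the surplus N - (k+1), give the codimension.
    rw [show P * (N + 1 + (k + 1)) = P * (k + N) + P + P by ring]
    omega
  · rw [Nat.cast_le]
    omega
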